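/- For $n \ge 1$ and $p \in [0,1]$ let $G(n,p)$ be the Erdős–Rényi random graph on the vertex set $\{1,\dots,n\}$, in which each of the $\binom n2$ possible edges is present independently with probability $p$. For every fixed $c \in \mathbb{R}$, $$\mathbb{P}\left( G\left(n, \frac{\log n + c}{n}\right) \text{ is connected}\right) \longrightarrow e^{-e^{-c}} \qquad \text{as } n \to \infty.$$ (For all sufficiently large $n$ one has $0 \le \frac{\log n + c}{n} \le 1$, so that the random graph is defined.) -/

import Mathlib

/-- The edge probability `(log n + c) / n`, as an element of `[0, 1]`. The projection onto `[0, 1]`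
acts on finitely many `n` only, see `eventually_coe_edgeProb`. -/
noncomputable def edgeProb (c : ℝ) (n : ℕ) : unitInterval :=
  Set.projIcc (0 : ℝ) 1 zero_le_one ((Real.log n + c) / n)

theorem eventually_coe_edgeProb (c : ℝ) :
    ∀ᶠ n : ℕ in Filter.atTop, ((edgeProb c n : unitInterval) : ℝ) = (Real.log n + c) / n := by
  have h1 : Filter.Tendsto (fun n : ℕ ↦ Real.log n + c) Filter.atTop Filter.atTop :=
    Filter.tendsto_atTop_add_const_right _ _
      (Real.tendsto_log_atTop.comp tendsto_natCast_atTop_atTop)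
  have h2 : Filter.Tendsto (fun n : ℕ ↦ (Real.log n + c) / n) Filter.atTop (nhds 0) := by
    have ha : Filter.Tendsto (fun x : ℝ ↦ Real.log x / x) Filter.atTop (nhds 0) :=
      Real.isLittleO_log_id_atTop.tendsto_div_nhds_zero
    have hb := (ha.comp (tendsto_natCast_atTop_atTop (R := ℝ))).add
      (tendsto_const_div_atTop_nhds_zero_nat c)
    simpa [add_div, Function.comp_def] using hb
  filter_upwards [h1.eventually_ge_atTop 0, h2.eventually_le_const one_pos] with n hn0 hn1
  simp only [edgeProb]
  rw [Set.projIcc_of_mem zero_le_one ⟨div_nonneg hn0 n.cast_nonneg, hn1⟩]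

/-! At this edge density isolated vertices are asymptotically the only obstruction to connectedness.
The number of isolated vertices has binomial moments tending to `exp (-c) ^ k / k!`;
inclusion-exclusion and dominated convergence give `exp (-exp (-c))` as the limiting probability
that none exists (`binomialRandom_no_isIsolated_tendsto`). A disconnected graph without isolated
vertices has an empty cut whose smaller side contains an edge. A union bound over cuts alone is
merely bounded, but that edge contributes a factor `p → 0` (`binomialRandom_not_connected_tendsto`).
One majorant, `factorialMajorant`, controls both sums. -/

/-! ### Uniform bounds on the terms of both sums. -/

/-- A summable majorant for the terms of the first moment and inclusion-exclusion sums. -/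
noncomputable def factorialMajorant (A : ℝ) (k : ℕ) : ℝ :=
  Real.exp (A * k + k * Real.log k / 2) / k.factorial

theorem factorialMajorant_nonneg (A : ℝ) (k : ℕ) : 0 ≤ factorialMajorant A k := by
  unfold factorialMajorant; positivity

/-- Since `k ^ k ≤ exp k * k!`, the square of a term is at most a product `a * b` of terms of an
exponential and a geometric series, and `a * b ≤ (a + b) ^ 2`. -/
theorem summable_factorialMajorant (A : ℝ) : Summable (factorialMajorant A) := by
  have h1 : Summable fun k : ℕ ↦ (4 * Real.exp (2 * A + 1)) ^ k / (k.factorial : ℝ) :=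
    Real.summable_pow_div_factorial _
  have h2 : Summable fun k : ℕ ↦ (1 / 4 : ℝ) ^ k :=
    summable_geometric_of_lt_one (by norm_num) (by norm_num)
  refine Summable.of_nonneg_of_le (factorialMajorant_nonneg A) (fun k ↦ ?_) (h1.add h2)
  have hf : (0 : ℝ) < k.factorial := by positivity
  have hk : Real.exp (k * Real.log k) ≤ Real.exp k * k.factorial := by
    have h := Real.pow_div_factorial_le_exp (x := (k : ℝ)) k.cast_nonneg k
    rw [div_le_iff₀ hf] at h
    refine le_trans (le_of_eq ?_) h
    rcases Nat.eq_zero_or_pos k with rfl | hk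
    · simp
    · rw [mul_comm, Real.exp_mul, Real.exp_log (by exact_mod_cast hk), Real.rpow_natCast]
  set x := factorialMajorant A k with hx
  have hsq : x ^ 2 ≤ (4 * Real.exp (2 * A + 1)) ^ k / (k.factorial : ℝ) * (1 / 4 : ℝ) ^ k := by
    have e1 : x ^ 2 = Real.exp (2 * A * k) * Real.exp (k * Real.log k) / (k.factorial : ℝ) ^ 2 := by
      rw [hx, factorialMajorant, div_pow, ← Real.exp_nat_mul, ← Real.exp_add]
      congr 2
      push_cast
      ring
    have e2 : (4 * Real.exp (2 * A + 1)) ^ k / (k.factorial : ℝ) * (1 / 4 : ℝ) ^ k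
        = Real.exp (2 * A * k) * (Real.exp k * k.factorial) / (k.factorial : ℝ) ^ 2 := by
      rw [mul_pow, ← Real.exp_nat_mul, div_pow, one_pow]
      have : Real.exp (k * (2 * A + 1)) = Real.exp (2 * A * k) * Real.exp k := by
        rw [← Real.exp_add]; congr 1; ring
      rw [this]
      field_simp
    rw [e1, e2]
    gcongr
  have ha : 0 ≤ (4 * Real.exp (2 * A + 1)) ^ k / (k.factorial : ℝ) := by positivity
  have hb : (0 : ℝ) ≤ (1 / 4) ^ k := by positivity
  refine abs_le_of_sq_le_sq' ?_ (add_nonneg ha hb) |>.2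
  nlinarith [mul_nonneg ha hb, sq_nonneg ((4 * Real.exp (2 * A + 1)) ^ k / (k.factorial : ℝ)),
    sq_nonneg ((1 / 4 : ℝ) ^ k)]

theorem summable_sq_mul_factorialMajorant (A : ℝ) :
    Summable fun k : ℕ ↦ (k : ℝ) ^ 2 * factorialMajorant A k := by
  refine Summable.of_nonneg_of_le
    (fun k ↦ mul_nonneg (by positivity) (factorialMajorant_nonneg A k)) (fun k ↦ ?_)
    ((summable_factorialMajorant (A + 1)).mul_left 2)
  have h := Real.pow_div_factorial_le_exp (x := (k : ℝ)) k.cast_nonneg 2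
  have e : factorialMajorant (A + 1) k = Real.exp k * factorialMajorant A k := by
    rw [factorialMajorant, factorialMajorant, ← mul_div_assoc, ← Real.exp_add]
    congr 2; ring
  rw [e, ← mul_assoc]
  refine mul_le_mul_of_nonneg_right ?_ (factorialMajorant_nonneg A k)
  norm_num [Nat.factorial] at h
  linarith

/-- `log x / x` increases up to `exp 1`; the extra `1` absorbs this and follows from `log (n / m) ≤
n / m - 1`. -/
theorem log_div_le_of_le {m n : ℝ} (hm : 1 ≤ m) (hmn : m ≤ n) :
    Real.log n / n ≤ (1 + Real.log m) / m := by
  have hm0 : 0 < m := by linarith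
  have hn : 0 < n := hm0.trans_le hmn
  have h1 : Real.log n = Real.log (n / m) + Real.log m := by
    rw [Real.log_div hn.ne' hm0.ne']; ring
  have h2 : Real.log (n / m) ≤ n / m - 1 := Real.log_le_sub_one_of_pos (by positivity)
  have h3 : Real.log (n / m) * m ≤ n := by
    calc _ ≤ (n / m - 1) * m := by gcongr
      _ = n - m := by field_simp
      _ ≤ n := by linarith
  rw [div_le_div_iff₀ hn hm0, h1]
  nlinarith [Real.log_nonneg hm]

/-- With `n.choose k ≤ n ^ k / k!` and `1 - p ≤ exp (-p)`, the powers of `n` cancel except for the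
deficit `k * n - e`, which `h` controls. -/
theorem choose_mul_pow_le_factorialMajorant {c p : ℝ} {n k e : ℕ} (hn : 0 < n) (hp : p ≤ 1)
    (hpe : p = (Real.log n + c) / n) (he : e ≤ k * n)
    (h : ((k : ℝ) * n - e) * (Real.log n / n) ≤ 2 * k + k * Real.log k / 2) :
    (n.choose k : ℝ) * (1 - p) ^ e ≤ factorialMajorant (|c| + 2) k := by
  have hn' : (0 : ℝ) < n := by exact_mod_cast hn
  have h1 : (1 - p) ^ e ≤ Real.exp (-(p * e)) := by
    calc (1 - p) ^ e ≤ Real.exp (-p) ^ e :=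
          pow_le_pow_left₀ (by linarith) (Real.one_sub_le_exp_neg p) e
      _ = _ := by rw [← Real.exp_nat_mul]; congr 1; ring
  have h2 : (n.choose k : ℝ) ≤ Real.exp (k * Real.log n) / k.factorial := by
    rw [mul_comm, Real.exp_mul, Real.exp_log hn', Real.rpow_natCast]
    exact Nat.choose_le_pow_div k n
  have h3 : -((e : ℝ) / n * c) ≤ |c| * k := by
    have he' : (e : ℝ) / n ≤ k := by
      rw [div_le_iff₀ hn']; exact_mod_cast he
    have : (0 : ℝ) ≤ e / n := by positivity
    nlinarith [neg_abs_le c, abs_nonneg c]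
  calc (n.choose k : ℝ) * (1 - p) ^ e
      ≤ Real.exp (k * Real.log n) / k.factorial * Real.exp (-(p * e)) :=
        mul_le_mul h2 h1 (pow_nonneg (by linarith) e) (by positivity)
    _ = Real.exp (k * Real.log n - p * e) / k.factorial := by
        rw [div_mul_eq_mul_div, ← Real.exp_add]; rfl
    _ ≤ _ := by
        rw [factorialMajorant]
        gcongr
        have e1 : k * Real.log n - p * e
            = ((k : ℝ) * n - e) * (Real.log n / n) + -((e : ℝ) / n * c) := by
          rw [hpe]; field_simp; ring
        rw [e1]
        linarith

theorem cut_exponent_bound {n k : ℕ} (hk : 0 < k) (h2 : 2 * k ≤ n) :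
    ((k : ℝ) * n - (k * (n - k) : ℕ)) * (Real.log n / n) ≤ 2 * k + k * Real.log k / 2 := by
  have hk' : (0 : ℝ) < k := by exact_mod_cast hk
  have h2' : 2 * (k : ℝ) ≤ n := by exact_mod_cast h2
  -- The deficit is `k ^ 2`, so `m = 2 * k` yields the coefficient `1 / 2` of `k * log k`; `m = k`
  -- would lose summability.
  have h := log_div_le_of_le (m := 2 * k) (by norm_cast; omega) h2'
  push_cast [show k ≤ n by omega]
  rw [Real.log_mul two_ne_zero hk'.ne'] at h
  calc ((k : ℝ) * n - k * (n - k)) * (Real.log n / n) = k ^ 2 * (Real.log n / n) := by ring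
    _ ≤ k ^ 2 * ((1 + (Real.log 2 + Real.log k)) / (2 * k)) := by gcongr
    _ = k * (1 + Real.log 2) / 2 + k * Real.log k / 2 := by field_simp; ring
    _ ≤ _ := by nlinarith [Real.log_two_lt_d9]

theorem isolated_exponent_cast {n k : ℕ} (hk : k ≤ n) :
    ((n.choose 2 - (n - k).choose 2 : ℕ) : ℝ) = k * n - k * (k + 1) / 2 := by
  rw [Nat.cast_sub (Nat.choose_le_choose 2 (Nat.sub_le n k)), Nat.cast_choose_two,
    Nat.cast_choose_two, Nat.cast_sub hk]
  ring

theorem isolated_exponent_bound {n k : ℕ} (hk : 0 < k) (h2 : k ≤ n) :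
    ((k : ℝ) * n - (n.choose 2 - (n - k).choose 2 : ℕ)) * (Real.log n / n)
      ≤ 2 * k + k * Real.log k / 2 := by
  have hk' : (1 : ℝ) ≤ k := by exact_mod_cast hk
  have h := log_div_le_of_le (m := k) (n := n) hk' (by exact_mod_cast h2)
  rw [isolated_exponent_cast h2]
  calc ((k : ℝ) * n - (k * n - k * (k + 1) / 2)) * (Real.log n / n)
      = k * (k + 1) / 2 * (Real.log n / n) := by ring
    _ ≤ k * (k + 1) / 2 * ((1 + Real.log k) / k) := by gcongr
    _ = (k + 1 + Real.log k) / 2 + k * Real.log k / 2 := by field_simp; ring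
    _ ≤ _ := by nlinarith [Real.log_le_sub_one_of_pos (show (0 : ℝ) < k by linarith)]

/-! ### Asymptotics of the edge probability. -/

theorem edgeProb_tendsto_zero (c : ℝ) :
    Filter.Tendsto (fun n ↦ (edgeProb c n : ℝ)) Filter.atTop (nhds 0) := by
  have ha : Filter.Tendsto (fun x : ℝ ↦ Real.log x / x) Filter.atTop (nhds 0) :=
    Real.isLittleO_log_id_atTop.tendsto_div_nhds_zero
  have hb := (ha.comp (tendsto_natCast_atTop_atTop (R := ℝ))).add
    (tendsto_const_div_atTop_nhds_zero_nat c)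
  have h2 : Filter.Tendsto (fun n : ℕ ↦ (Real.log n + c) / n) Filter.atTop (nhds 0) := by
    simpa [add_div, Function.comp_def] using hb
  refine h2.congr' ?_
  filter_upwards [eventually_coe_edgeProb c] with n hn using hn.symm

theorem natCast_mul_edgeProb_sq_tendsto_zero (c : ℝ) :
    Filter.Tendsto (fun n : ℕ ↦ n * (edgeProb c n : ℝ) ^ 2) Filter.atTop (nhds 0) := by
  have h1 : Filter.Tendsto (fun x : ℝ ↦ Real.log x / x) Filter.atTop (nhds 0) :=
    Real.isLittleO_log_id_atTop.tendsto_div_nhds_zero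
  have h2 : Filter.Tendsto (fun x : ℝ ↦ Real.log x ^ 2 / x) Filter.atTop (nhds 0) :=
    Real.isLittleO_pow_log_id_atTop.tendsto_div_nhds_zero
  have hb := (((h2.comp (tendsto_natCast_atTop_atTop (R := ℝ))).add
    ((h1.comp (tendsto_natCast_atTop_atTop (R := ℝ))).const_mul (2 * c))).add
    (tendsto_const_div_atTop_nhds_zero_nat (c ^ 2)))
  simp only [mul_zero, add_zero] at hb
  refine hb.congr' ?_
  filter_upwards [eventually_coe_edgeProb c, Filter.eventually_gt_atTop 0] with n hn h0
  have : (n : ℝ) ≠ 0 := by positivity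
  rw [hn]
  simp only [Function.comp_apply]
  field_simp
  ring

/-- As `n * p = log n + c`, the logarithm is `-c + n * (p + log (1 - p))`, with error at most `2 * n
* p ^ 2`. -/
theorem natCast_mul_one_sub_edgeProb_pow_tendsto (c : ℝ) :
    Filter.Tendsto (fun n : ℕ ↦ n * (1 - (edgeProb c n : ℝ)) ^ n) Filter.atTop
      (nhds (Real.exp (-c))) := by
  have hp := edgeProb_tendsto_zero c
  have h0 : Filter.Tendsto (fun n : ℕ ↦ n * ((edgeProb c n : ℝ) + Real.log (1 - edgeProb c n)))
      Filter.atTop (nhds 0) := by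
    refine squeeze_zero_norm' ?_
      (by simpa using (natCast_mul_edgeProb_sq_tendsto_zero c).const_mul 2)
    filter_upwards [hp.eventually_le_const (show (0 : ℝ) < 1 / 2 by norm_num)] with n hn
    have hnn : 0 ≤ (edgeProb c n : ℝ) := (edgeProb c n).2.1
    have h := Real.abs_log_sub_add_sum_range_le (x := edgeProb c n)
      (by rw [abs_of_nonneg hnn]; linarith) 1
    simp only [Finset.range_one, Finset.sum_singleton, Nat.cast_zero, zero_add, pow_one, div_one,
      abs_of_nonneg hnn] at h
    rw [Real.norm_eq_abs, abs_mul, Nat.abs_cast, mul_left_comm]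
    gcongr
    refine h.trans ?_
    rw [div_le_iff₀ (by linarith)]
    norm_num
    nlinarith [sq_nonneg (edgeProb c n : ℝ)]
  have h1 := (Real.continuous_exp.tendsto _).comp (h0.const_add (-c))
  rw [add_zero] at h1
  refine h1.congr' ?_
  filter_upwards [eventually_coe_edgeProb c, Filter.eventually_gt_atTop 0,
    hp.eventually_lt_const (show (0 : ℝ) < 1 by norm_num)] with n hn hn0 hn1
  have hn' : (0 : ℝ) < n := by exact_mod_cast hn0
  have e : -c + n * ((edgeProb c n : ℝ) + Real.log (1 - edgeProb c n))
      = Real.log n + n * Real.log (1 - edgeProb c n) := by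
    rw [mul_add]; nth_rw 1 [hn]; field_simp; ring
  simp only [Function.comp_apply]
  rw [e, Real.exp_add, Real.exp_log hn', Real.exp_nat_mul, Real.exp_log (by linarith)]

/-- The exponent differs from `n * k` by the constant `(k + 1).choose 2`, which is harmless because
`1 - p → 1`. -/
theorem choose_mul_pow_isolated_tendsto (c : ℝ) (k : ℕ) :
    Filter.Tendsto (fun n : ℕ ↦ (n.choose k : ℝ) *
        (1 - (edgeProb c n : ℝ)) ^ (n.choose 2 - (n - k).choose 2))
      Filter.atTop (nhds (Real.exp (-c) ^ k / k.factorial)) := by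
  have h1 := ProbabilityTheory.tendsto_choose_mul_pow_atTop (k := k)
    (natCast_mul_one_sub_edgeProb_pow_tendsto c)
  have h2 : Filter.Tendsto (fun n : ℕ ↦ (1 - (edgeProb c n : ℝ)) ^ ((k + 1).choose 2))
      Filter.atTop (nhds 1) := by
    simpa using ((edgeProb_tendsto_zero c).const_sub 1).pow ((k + 1).choose 2)
  have h3 := h1.div h2 one_ne_zero
  rw [div_one] at h3
  refine h3.congr' ?_
  filter_upwards [Filter.eventually_ge_atTop k,
    (edgeProb_tendsto_zero c).eventually_lt_const (show (0 : ℝ) < 1 by norm_num)] with n hn hn1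
  have e : n * k = (n.choose 2 - (n - k).choose 2) + (k + 1).choose 2 := by
    have : ((n * k : ℕ) : ℝ)
        = ((n.choose 2 - (n - k).choose 2 + (k + 1).choose 2 : ℕ) : ℝ) := by
      rw [Nat.cast_add, isolated_exponent_cast hn, Nat.cast_choose_two]
      push_cast
      ring
    exact_mod_cast this
  have hne : (1 - (edgeProb c n : ℝ)) ≠ 0 := by linarith
  simp only [Pi.div_apply]
  rw [← pow_mul, e, pow_add, ← mul_assoc, mul_div_cancel_right₀ _ (pow_ne_zero _ hne)]

/-! ### Probabilities of prescribed absent and present edges. -/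

open MeasureTheory in
theorem setBernoulli_real_disjoint {ι : Type*} [Countable ι] (u : Set ι) (p : unitInterval)
    (A : Finset ι) (hA : ↑A ⊆ u) :
    (ProbabilityTheory.setBernoulli u p).real {s | ∀ i ∈ A, i ∉ s} = (1 - (p : ℝ)) ^ A.card := by
  rw [measureReal_def, ProbabilityTheory.setBernoulli_apply']
  have e : ((fun q : ι → Prop ↦ {i | q i}) ⁻¹' {s | ∀ i ∈ A, i ∉ s})
      = Set.pi (A : Set ι) (fun _ ↦ ({False} : Set Prop)) := by
    ext q; simp
  rw [e, Measure.infinitePi_pi _ (fun _ _ ↦ measurableSet_singleton _)]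
  rw [Finset.prod_congr rfl (g := fun _ ↦ (unitInterval.toNNReal (unitInterval.symm p) : ENNReal))]
  · simp
  · intro i hi
    have : i ∈ u := hA hi
    simp [this]

namespace SimpleGraph

open MeasureTheory

variable {V : Type*} [Fintype V]

instance : MeasurableSingletonClass (SimpleGraph V) where
  measurableSet_singleton G := by
    have h := measurable_edgeSet (V := V) (measurableSet_singleton G.edgeSet)
    convert h using 1
    ext H
    simp

theorem binomialRandom_real_edges_absent (p : unitInterval) (A : Finset (Sym2 V))
    (hA : ∀ e ∈ A, ¬ e.IsDiag) :
    (binomialRandom V p).real {G | ∀ e ∈ A, e ∉ G.edgeSet} = (1 - (p : ℝ)) ^ A.card := by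
  rw [← setBernoulli_real_disjoint (Sym2.diagSetᶜ) p A (fun e he ↦ by simpa using hA e he),
    binomialRandom_eq_map, measureReal_def, Measure.map_apply measurable_fromEdgeSet]
  · rw [← measureReal_def]
    congr 1
    ext s
    simp only [Set.mem_preimage, Set.mem_ofPred_eq, edgeSet_fromEdgeSet, Set.mem_sdiff]
    refine forall₂_congr fun e he ↦ ?_
    simp [hA e he]
  · exact (Set.toFinite _).measurableSet

variable [DecidableEq V]

theorem binomialRandom_real_edges_absent_and_mem (p : unitInterval) (A : Finset (Sym2 V))
    (hA : ∀ e ∈ A, ¬ e.IsDiag) {e : Sym2 V} (he : ¬ e.IsDiag) (heA : e ∉ A) :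
    (binomialRandom V p).real {G | (∀ e ∈ A, e ∉ G.edgeSet) ∧ e ∈ G.edgeSet}
      = p * (1 - (p : ℝ)) ^ A.card := by
  have h1 := binomialRandom_real_edges_absent p A hA
  have h2 := binomialRandom_real_edges_absent p (insert e A) (by simpa [he] using hA)
  have h3 : {G : SimpleGraph V | (∀ e ∈ A, e ∉ G.edgeSet) ∧ e ∈ G.edgeSet}
      = {G | ∀ e ∈ A, e ∉ G.edgeSet} \ {G | ∀ f ∈ insert e A, f ∉ G.edgeSet} := by
    ext G
    simp only [Set.mem_ofPred_eq, Set.mem_sdiff, Finset.mem_insert, forall_eq_or_imp]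
    tauto
  have h4 : {G : SimpleGraph V | ∀ f ∈ insert e A, f ∉ G.edgeSet}
      ⊆ {G | ∀ e ∈ A, e ∉ G.edgeSet} :=
    Set.ofPred_subset_ofPred.2 fun G hG f hf ↦ hG f (Finset.mem_insert_of_mem hf)
  rw [h3, measureReal_sdiff h4 (Set.toFinite _).measurableSet, h1, h2, Finset.card_insert_of_notMem heA, pow_succ]
  ring

/-! ### Edges meeting a vertex set and edges leaving it. -/

/-- The possible edges meeting `S`. -/
def edgesMeeting (S : Finset V) : Finset (Sym2 V) :=
  Finset.univ.offDiag.image Sym2.mk.uncurry \ Sᶜ.offDiag.image Sym2.mk.uncurry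

/-- The possible edges between `S` and its complement. -/
def edgesCrossing (S : Finset V) : Finset (Sym2 V) :=
  (S ×ˢ Sᶜ).image Sym2.mk.uncurry

theorem mk_mem_edgesMeeting {S : Finset V} {u v : V} :
    s(u, v) ∈ edgesMeeting S ↔ u ≠ v ∧ (u ∈ S ∨ v ∈ S) := by
  have h : ∀ T : Finset V, s(u, v) ∈ T.offDiag.image Sym2.mk.uncurry ↔ u ∈ T ∧ v ∈ T ∧ u ≠ v :=
    fun T ↦ by
    simp only [Finset.mem_image, Finset.mem_offDiag, Prod.exists, Function.uncurry_apply_pair,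
      Sym2.eq_iff]
    constructor
    · rintro ⟨a, b, ⟨ha, hb, hab⟩, ⟨rfl, rfl⟩ | ⟨rfl, rfl⟩⟩
      · exact ⟨ha, hb, hab⟩
      · exact ⟨hb, ha, hab.symm⟩
    · exact fun h ↦ ⟨u, v, h, Or.inl ⟨rfl, rfl⟩⟩
  rw [edgesMeeting, Finset.mem_sdiff, h, h]
  simp only [Finset.mem_univ, Finset.mem_compl]
  tauto

theorem mk_mem_edgesCrossing {S : Finset V} {u v : V} :
    s(u, v) ∈ edgesCrossing S ↔ (u ∈ S ∧ v ∉ S) ∨ (v ∈ S ∧ u ∉ S) := by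
  simp [edgesCrossing]
  grind

theorem card_edgesMeeting (S : Finset V) :
    (edgesMeeting S).card
      = (Fintype.card V).choose 2 - (Fintype.card V - S.card).choose 2 := by
  have hsub : Sᶜ.offDiag ⊆ (Finset.univ : Finset V).offDiag :=
    Finset.offDiag_mono (Finset.subset_univ _)
  rw [edgesMeeting, Finset.card_sdiff_of_subset (Finset.image_subset_image hsub)]
  have h := fun s : Finset V ↦ Sym2.card_image_offDiag s
  rw [h, h, Finset.card_compl, Finset.card_univ]

theorem card_edgesCrossing (S : Finset V) :
    (edgesCrossing S).card = S.card * (Fintype.card V - S.card) := by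
  rw [edgesCrossing, Finset.card_image_of_injOn, Finset.card_product, Finset.card_compl]
  rintro ⟨a, b⟩ hab ⟨x, y⟩ hxy h
  simp at hab hxy h
  grind

theorem not_isDiag_of_mem_edgesMeeting {S : Finset V} {e : Sym2 V} (he : e ∈ edgesMeeting S) :
    ¬ e.IsDiag := by
  induction e with
  | h u v => simpa using (mk_mem_edgesMeeting.1 he).1

theorem not_isDiag_of_mem_edgesCrossing {S : Finset V} {e : Sym2 V} (he : e ∈ edgesCrossing S) :
    ¬ e.IsDiag := by
  induction e with
  | h u v =>
    rw [mk_mem_edgesCrossing] at he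
    rintro (rfl : u = v)
    tauto

theorem forall_isIsolated_iff_edgesMeeting {S : Finset V} {G : SimpleGraph V} :
    (∀ v ∈ S, G.IsIsolated v) ↔ ∀ e ∈ edgesMeeting S, e ∉ G.edgeSet := by
  constructor
  · intro h e
    induction e with
    | h u v =>
      rw [mk_mem_edgesMeeting, mem_edgeSet]
      rintro ⟨-, hu | hv⟩ huv
      · exact h u hu v huv
      · exact h v hv u huv.symm
  · intro h v hv w hvw
    exact h s(v, w) (mk_mem_edgesMeeting.2 ⟨hvw.ne, Or.inl hv⟩) hvw

theorem binomialRandom_real_forall_isIsolated (p : unitInterval) (S : Finset V) :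
    (binomialRandom V p).real {G | ∀ v ∈ S, G.IsIsolated v}
      = (1 - (p : ℝ)) ^ ((Fintype.card V).choose 2 - (Fintype.card V - S.card).choose 2) := by
  simp_rw [forall_isIsolated_iff_edgesMeeting]
  rw [binomialRandom_real_edges_absent p _ fun _ ↦ not_isDiag_of_mem_edgesMeeting,
    card_edgesMeeting]

/-! ### Inclusion-exclusion and the union bound over cuts. -/

/-- The probability that no vertex is isolated, by inclusion-exclusion. -/
theorem binomialRandom_real_no_isIsolated (p : unitInterval) :
    (binomialRandom V p).real {G | ∀ v, ¬ G.IsIsolated v}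
      = ∑ k ∈ Finset.range (Fintype.card V + 1), (-1 : ℝ) ^ k *
        (((Fintype.card V).choose k : ℝ) *
          (1 - (p : ℝ)) ^ ((Fintype.card V).choose 2 - (Fintype.card V - k).choose 2)) := by
  classical
  have := Fintype.ofFinite (SimpleGraph V)
  have hμ : ∀ T : Finset (SimpleGraph V),
      ∑ G ∈ T, (binomialRandom V p).real {G} = (binomialRandom V p).real ↑T := fun T ↦
    sum_measureReal_singleton T
  -- Each graph is weighted by its point mass.
  have h := Finset.inclusion_exclusion_sum_inf_compl (Finset.univ : Finset V)
    (fun v ↦ Finset.univ.filter fun G : SimpleGraph V ↦ G.IsIsolated v)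
    (fun G ↦ (binomialRandom V p).real {G})
  simp_rw [hμ] at h
  have e1 : ((Finset.univ.inf fun v : V ↦
      (Finset.univ.filter fun G : SimpleGraph V ↦ G.IsIsolated v)ᶜ : Finset (SimpleGraph V)) :
      Set (SimpleGraph V)) = {G | ∀ v, ¬ G.IsIsolated v} := by
    ext G; simp [Finset.mem_inf]
  have e2 : ∀ S : Finset V, ((S.inf fun v : V ↦
      (Finset.univ.filter fun G : SimpleGraph V ↦ G.IsIsolated v) : Finset (SimpleGraph V)) :
      Set (SimpleGraph V)) = {G | ∀ v ∈ S, G.IsIsolated v} := fun S ↦ by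
    ext G; simp [Finset.mem_inf]
  simp_rw [e1, e2, binomialRandom_real_forall_isIsolated] at h
  rw [h, Finset.sum_powerset_apply_card (fun k ↦ (-1 : ℤ) ^ k •
    (1 - (p : ℝ)) ^ ((Fintype.card V).choose 2 - (Fintype.card V - k).choose 2)), Finset.card_univ]
  refine Finset.sum_congr rfl fun k _ ↦ ?_
  rw [nsmul_eq_mul, zsmul_eq_mul]
  push_cast
  ring

/-- A disconnected graph without isolated vertices has a cut with no crossing edge, whose smaller
side contains an edge. -/
theorem exists_cut_of_not_connected [Nonempty V] {G : SimpleGraph V} (hG : ¬ G.Connected)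
    (hiso : ∀ v, ¬ G.IsIsolated v) :
    ∃ S : Finset V, 0 < S.card ∧ 2 * S.card ≤ Fintype.card V ∧
      (∀ e ∈ edgesCrossing S, e ∉ G.edgeSet) ∧ ∃ u ∈ S, ∃ v ∈ S, u ≠ v ∧ G.Adj u v := by
  classical
  rw [connected_iff_exists_forall_reachable] at hG
  push Not at hG
  obtain ⟨a⟩ := ‹Nonempty V›
  obtain ⟨b, hab⟩ := hG a
  set C : Finset V := Finset.univ.filter fun v ↦ G.Reachable a v with hC
  have hclosed : ∀ u v, G.Adj u v → (u ∈ C ↔ v ∈ C) := fun u v huv ↦ by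
    simp only [hC, Finset.mem_filter, Finset.mem_univ, true_and]
    exact ⟨fun h ↦ h.trans huv.reachable, fun h ↦ h.trans huv.symm.reachable⟩
  -- Both the component of `a` and its complement are closed under adjacency; the smaller one serves
  -- as `S`.
  have key : ∀ S : Finset V, (∀ u v, G.Adj u v → (u ∈ S ↔ v ∈ S)) → S.Nonempty →
      2 * S.card ≤ Fintype.card V → ∃ S : Finset V, 0 < S.card ∧ 2 * S.card ≤ Fintype.card V ∧
      (∀ e ∈ edgesCrossing S, e ∉ G.edgeSet) ∧ ∃ u ∈ S, ∃ v ∈ S, u ≠ v ∧ G.Adj u v := by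
    intro S hS hne hcard
    obtain ⟨x, hx⟩ := hne
    obtain ⟨y, hxy⟩ := exists_adj_iff_not_isIsolated.2 (hiso x)
    refine ⟨S, Finset.card_pos.2 ⟨x, hx⟩, hcard, fun e ↦ ?_,
      x, hx, y, (hS x y hxy).1 hx, hxy.ne, hxy⟩
    induction e with
    | h u v =>
      rw [mk_mem_edgesCrossing, mem_edgeSet]
      intro h huv
      have := hS u v huv
      tauto
  have haC : a ∈ C := by simp [hC]
  have hbC : b ∈ Cᶜ := by simpa [hC] using hab
  have hsum := Finset.card_add_card_compl C
  rcases le_total C.card Cᶜ.card with h | h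
  · exact key C hclosed ⟨a, haC⟩ (by omega)
  · refine key Cᶜ (fun u v huv ↦ ?_) ⟨b, hbC⟩ (by omega)
    rw [Finset.mem_compl, Finset.mem_compl, hclosed u v huv]

/-- Union bound over `S` and ordered pairs in `S`, at most `k ^ 2` of them; a pair inside `S` does
not cross the cut, whence the separate factor `p`. -/
theorem binomialRandom_real_not_connected_le [Nonempty V] (p : unitInterval) :
    (binomialRandom V p).real {G | ¬ G.Connected ∧ ∀ v, ¬ G.IsIsolated v}
      ≤ ∑ k ∈ (Finset.range (Fintype.card V + 1)).filter (fun k ↦ 0 < k ∧ 2 * k ≤ Fintype.card V),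
        (k : ℝ) ^ 2 * p * (((Fintype.card V).choose k : ℝ) *
          (1 - (p : ℝ)) ^ (k * (Fintype.card V - k))) := by
  classical
  set n := Fintype.card V with hn
  set 𝒮 := (Finset.univ : Finset V).powerset.filter (fun S ↦ 0 < S.card ∧ 2 * S.card ≤ n) with h𝒮
  have hsub : {G : SimpleGraph V | ¬ G.Connected ∧ ∀ v, ¬ G.IsIsolated v} ⊆
      ⋃ S ∈ 𝒮, ⋃ e ∈ S.offDiag,
        {G | (∀ f ∈ edgesCrossing S, f ∉ G.edgeSet) ∧ s(e.1, e.2) ∈ G.edgeSet} := by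
    rintro G ⟨hG, hiso⟩
    obtain ⟨S, h0, h2, hS, u, hu, v, hv, huv, hadj⟩ := exists_cut_of_not_connected hG hiso
    simp only [Set.mem_iUnion]
    exact ⟨S, by simp [h𝒮, hn, h2, Finset.card_pos.1 h0], (u, v), by simp [hu, hv, huv], hS, hadj⟩
  have hS : ∀ S : Finset V, (binomialRandom V p).real (⋃ e ∈ S.offDiag,
      {G | (∀ f ∈ edgesCrossing S, f ∉ G.edgeSet) ∧ s(e.1, e.2) ∈ G.edgeSet})
      ≤ (S.card : ℝ) ^ 2 * (p * (1 - (p : ℝ)) ^ (S.card * (n - S.card))) := fun S ↦ by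
    have hnn : 0 ≤ (p : ℝ) * (1 - (p : ℝ)) ^ (S.card * (n - S.card)) :=
      mul_nonneg p.2.1 (pow_nonneg (by linarith [p.2.2]) _)
    refine (measureReal_biUnion_finset_le _ _).trans ?_
    refine (Finset.sum_le_card_nsmul _ _ (p * (1 - (p : ℝ)) ^ (S.card * (n - S.card)))
      fun e he ↦ ?_).trans ?_
    · rw [Finset.mem_offDiag] at he
      rw [binomialRandom_real_edges_absent_and_mem p _ (fun _ ↦ not_isDiag_of_mem_edgesCrossing)
        (by simpa using he.2.2) (by rw [mk_mem_edgesCrossing]; tauto), card_edgesCrossing]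
    · rw [nsmul_eq_mul]
      refine mul_le_mul_of_nonneg_right ?_ hnn
      rw [Finset.offDiag_card]
      have : S.card * S.card - S.card ≤ S.card ^ 2 := by rw [sq]; exact Nat.sub_le _ _
      exact_mod_cast this
  calc (binomialRandom V p).real {G | ¬ G.Connected ∧ ∀ v, ¬ G.IsIsolated v} ≤ _ := measureReal_mono hsub (measure_ne_top _ _)
    _ ≤ _ := measureReal_biUnion_finset_le _ _
    _ ≤ ∑ S ∈ 𝒮, (S.card : ℝ) ^ 2 * (p * (1 - (p : ℝ)) ^ (S.card * (n - S.card))) :=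
      Finset.sum_le_sum fun S _ ↦ hS S
    _ = ∑ S ∈ (Finset.univ : Finset V).powerset, if 0 < S.card ∧ 2 * S.card ≤ n then
        (S.card : ℝ) ^ 2 * (p * (1 - (p : ℝ)) ^ (S.card * (n - S.card))) else 0 := by
      rw [h𝒮, Finset.sum_filter]
    _ = _ := by
      rw [Finset.sum_powerset_apply_card (fun k ↦ if 0 < k ∧ 2 * k ≤ n then
        (k : ℝ) ^ 2 * (p * (1 - (p : ℝ)) ^ (k * (n - k))) else 0), Finset.card_univ,
        Finset.sum_filter]
      refine Finset.sum_congr rfl fun k _ ↦ ?_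
      split_ifs
      · rw [nsmul_eq_mul]; ring
      · simp

end SimpleGraph

/-! ### Passage to the limit. -/

open Filter Topology MeasureTheory

theorem binomialRandom_no_isIsolated_tendsto (c : ℝ) :
    Tendsto (fun n : ℕ ↦ (SimpleGraph.binomialRandom (Fin n) (edgeProb c n)).real
      {G : SimpleGraph (Fin n) | ∀ v, ¬ G.IsIsolated v}) atTop (𝓝 (Real.exp (-Real.exp (-c)))) := by
  set f : ℕ → ℕ → ℝ := fun n k ↦ (-1 : ℝ) ^ k * ((n.choose k : ℝ) *
    (1 - (edgeProb c n : ℝ)) ^ (n.choose 2 - (n - k).choose 2)) with hf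
  have h1 : ∀ n : ℕ, (SimpleGraph.binomialRandom (Fin n) (edgeProb c n)).real
      {G : SimpleGraph (Fin n) | ∀ v, ¬ G.IsIsolated v} = ∑' k, f n k := fun n ↦ by
    rw [SimpleGraph.binomialRandom_real_no_isIsolated, Fintype.card_fin,
      tsum_eq_sum (s := Finset.range (n + 1))]
    intro k hk
    have : n < k := by simpa using hk
    simp [hf, Nat.choose_eq_zero_of_lt this]
  have h2 : Real.exp (-Real.exp (-c))
      = ∑' k : ℕ, (-1 : ℝ) ^ k * (Real.exp (-c) ^ k / k.factorial) := by
    rw [Real.exp_eq_exp_ℝ, NormedSpace.exp_eq_tsum_div]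
    refine tsum_congr fun k ↦ ?_
    rw [neg_pow, mul_div_assoc]
  simp_rw [h1]
  rw [h2]
  refine tendsto_tsum_of_dominated_convergence (summable_factorialMajorant (|c| + 2))
    (fun k ↦ (choose_mul_pow_isolated_tendsto c k).const_mul _) ?_
  filter_upwards [eventually_coe_edgeProb c, eventually_gt_atTop 0] with n hn hn0 k
  have hp := (edgeProb c n).2
  have hnn : 0 ≤ (n.choose k : ℝ) *
      (1 - (edgeProb c n : ℝ)) ^ (n.choose 2 - (n - k).choose 2) :=
    mul_nonneg (Nat.cast_nonneg _) (pow_nonneg (by linarith [hp.2]) _)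
  rw [Real.norm_eq_abs, abs_mul, abs_pow, abs_neg, abs_one, one_pow, one_mul, abs_of_nonneg hnn]
  rcases lt_or_ge n k with hk | hk
  · simpa [Nat.choose_eq_zero_of_lt hk] using factorialMajorant_nonneg _ _
  rcases Nat.eq_zero_or_pos k with rfl | hk0
  · simp [factorialMajorant]
  refine choose_mul_pow_le_factorialMajorant hn0 hp.2 hn ?_ (isolated_exponent_bound hk0 hk)
  have : ((n.choose 2 - (n - k).choose 2 : ℕ) : ℝ) ≤ (k * n : ℕ) := by
    rw [isolated_exponent_cast hk]
    push_cast
    have : (0 : ℝ) ≤ k * (k + 1) / 2 := by positivity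
    linarith
  exact_mod_cast this

theorem binomialRandom_not_connected_tendsto (c : ℝ) :
    Tendsto (fun n : ℕ ↦ (SimpleGraph.binomialRandom (Fin n) (edgeProb c n)).real
      {G : SimpleGraph (Fin n) | ¬ G.Connected ∧ ∀ v, ¬ G.IsIsolated v}) atTop (𝓝 0) := by
  have hs := summable_sq_mul_factorialMajorant (|c| + 2)
  have hlim : Tendsto (fun n ↦ (edgeProb c n : ℝ) *
      ∑' k : ℕ, (k : ℝ) ^ 2 * factorialMajorant (|c| + 2) k) atTop (𝓝 0) := by
    simpa using (edgeProb_tendsto_zero c).mul_const _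
  refine squeeze_zero' (.of_forall fun n ↦ measureReal_nonneg) ?_ hlim
  filter_upwards [eventually_coe_edgeProb c, eventually_gt_atTop 0] with n hn hn0
  have : Nonempty (Fin n) := ⟨⟨0, hn0⟩⟩
  have hp := (edgeProb c n).2
  refine (SimpleGraph.binomialRandom_real_not_connected_le _).trans ?_
  rw [Fintype.card_fin]
  refine le_trans ?_ (mul_le_mul_of_nonneg_left (hs.sum_le_tsum
    ((Finset.range (n + 1)).filter fun k ↦ 0 < k ∧ 2 * k ≤ n)
    fun k _ ↦ mul_nonneg (by positivity) (factorialMajorant_nonneg _ k)) hp.1)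
  rw [Finset.mul_sum]
  refine Finset.sum_le_sum fun k hk ↦ ?_
  obtain ⟨-, hk0, hk2⟩ := Finset.mem_filter.1 hk
  rw [mul_comm ((k : ℝ) ^ 2), mul_assoc]
  refine mul_le_mul_of_nonneg_left (mul_le_mul_of_nonneg_left ?_ (by positivity)) hp.1
  exact choose_mul_pow_le_factorialMajorant hn0 hp.2 hn
    (Nat.mul_le_mul_left k (Nat.sub_le n k)) (cut_exponent_bound hk0 hk2)

theorem mainTheorem2 (c : ℝ) :
    Filter.Tendsto
      (fun n : ℕ ↦ (SimpleGraph.binomialRandom (Fin n) (edgeProb c n)).real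
        {G : SimpleGraph (Fin n) | G.Connected})
      Filter.atTop (nhds (Real.exp (-Real.exp (-c)))) := by
  have h := (binomialRandom_no_isIsolated_tendsto c).sub (binomialRandom_not_connected_tendsto c)
  rw [sub_zero] at h
  refine h.congr' ?_
  -- For `n = 1` the graph is connected although its vertex is isolated.
  filter_upwards [eventually_ge_atTop 2] with n hn
  have : Nontrivial (Fin n) := Fin.nontrivial_iff_two_le.2 hn
  rw [← measureReal_sdiff (Set.ofPred_subset_ofPred.2 fun G hG ↦ hG.2) (Set.toFinite _).measurableSet]
  congr 1
  ext G
  simp only [Set.mem_sdiff, Set.mem_ofPred_eq]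
  constructor
  · tauto
  · intro hG
    exact ⟨fun v ↦ hG.preconnected.not_isIsolated v, fun h ↦ h.1 hG⟩
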